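/- Let $\mathrm{Ai}$ be the Airy function (an entire function), let $\alpha = 2\pi/3$, and let $a'_1 > a'_2 > \cdots$ be the real zeros of $\mathrm{Ai}'$ (all negative), numbered from the right. For $n \ge 1$ put $\lambda_n^{\pm} = e^{\pm i\alpha} a'_n$, and define $$f(\lambda) = 2\pi\, \mathrm{Ai}'(e^{-i\alpha}\lambda)\, \mathrm{Ai}'(e^{i\alpha}\lambda), \qquad \lambda \in \mathbb{C}.$$ Below, $B(\lambda, r)$ is the open disc in $\mathbb{C}$ with centre $\lambda$ and radius $r$, and $\lambda_n$ stands for either of $\lambda_n^+$, $\lambda_n^-$. 1. There exist $\eta > 0$ and $h_\infty > 0$ such that, for all $n \ge 1$, for both choices of $\lambda_n$ and for every $\kappa \in \mathbb{C}$ with $|\kappa| \le h_\infty$, the equation $f(\lambda) = -\kappa$ has exactly one solution $\lambda$ in $B(\lambda_n, \eta |\lambda_n|^{-1})$. 2. For every $\eta > 0$ and every real $\kappa$ with $0 \le \kappa < \eta/2$ there exists $N$ such that, for all $n \ge N$ and for both choices of $\lambda_n$, the equation $f(\lambda) = -\kappa$ has exactly one solution $\lambda$ in $B(\lambda_n, \eta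 |\lambda_n|^{-1})$. 3. For every $\eta > 0$ there exists $N$ such that, for all $n \ge N$ and for both choices of $\lambda_n$, the function $\phi_n(t) = f(\lambda_n + t \lambda_n^{-1})$ satisfies $|\phi_n'(t)| \ge \tfrac12$ for all $t \in B(0, \eta)$. -/

import Mathlib

open Real Set

noncomputable section

namespace ComplexAiry

/-- The contribution `∫ exp (t ^ 3 / 3 - z * t) dt` of the ray `t = ω s`, `0 < s < ∞`. For
`ω = exp (± i π / 3)` one has `ω ^ 3 = -1`, so that the integral converges absolutely for every
complex `z`. -/
def airyRay (ω z : ℂ) : ℂ :=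
  ∫ s in Ioi (0 : ℝ), Complex.exp ((ω * (s : ℂ)) ^ 3 / 3 - z * (ω * (s : ℂ))) * ω

/-- The Airy function `Ai`, as an entire function:
`Ai z = (2 π i)⁻¹ ∫ exp (t ^ 3 / 3 - z t) dt` over the contour that comes in from `∞ exp (- i π / 3)`
along a ray to the origin and goes out to `∞ exp (i π / 3)` along a ray. It is the solution of
`u'' = z u` that tends to `0` at `+∞` on the real line and has
`Ai 0 = 1 / (3 ^ (2 / 3) Γ (2 / 3))`. -/
def airyAi (z : ℂ) : ℂ :=
  (2 * (π : ℂ) * Complex.I)⁻¹ *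
    (airyRay (Complex.exp (Complex.I * (π : ℂ) / 3)) z
      - airyRay (Complex.exp (-(Complex.I * (π : ℂ) / 3))) z)

/-- The derivative `Ai'` of the Airy function. -/
def airyAiDeriv (z : ℂ) : ℂ := deriv airyAi z

/-- The set of (real) zeros of `Ai'`. -/
def airyAiDerivZeros : Set ℝ := {x : ℝ | airyAiDeriv (x : ℂ) = 0}

/-- `aPrime n`, for `n ≥ 1`, is the `n`-th zero of `Ai'`, counted from the right: `aPrime 1` is the
largest zero, and `aPrime (n + 1)` is the largest zero that is smaller than `aPrime n`.
The value at `n = 0` is not used. -/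
def aPrime : ℕ → ℝ
  | 0 => 0
  | 1 => sSup airyAiDerivZeros
  | n + 2 => sSup {x : ℝ | x ∈ airyAiDerivZeros ∧ x < aPrime (n + 1)}

/-- The angle `α = 2 π / 3`. -/
def alpha : ℝ := 2 * π / 3

/-- `λ_n⁺ = exp (i α) a'_n`. -/
def lamPlus (n : ℕ) : ℂ := Complex.exp (Complex.I * (alpha : ℂ)) * (aPrime n : ℂ)

/-- `λ_n⁻ = exp (- i α) a'_n`. -/
def lamMinus (n : ℕ) : ℂ := Complex.exp (-(Complex.I * (alpha : ℂ))) * (aPrime n : ℂ)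

/-- `f λ = 2 π Ai' (exp (- i α) λ) Ai' (exp (i α) λ)`. -/
def f (l : ℂ) : ℂ :=
  2 * (π : ℂ) * airyAiDeriv (Complex.exp (-(Complex.I * (alpha : ℂ))) * l)
    * airyAiDeriv (Complex.exp (Complex.I * (alpha : ℂ)) * l)

/-- The rescaled function `φ t = f (l + t l⁻¹)` around a point `l`. -/
def phi (l t : ℂ) : ℂ := f (l + t * l⁻¹)

end ComplexAiry

end

/-!
Let `σ = exp (± i α)`, so that `σ ^ 2 + σ + 1 = 0`, put `u w = Ai w` and `V w = Ai (σ ^ 2 w)`, two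
solutions of the Airy equation, and let `W = u V' - u' V` be their constant Wronskian. Its modulus is
`1 / (2 π)`, by the values of `Ai` and `Ai'` at `0` and the reflection formula for `Γ`
(`wronskian_airyAi`, `norm_phaseWronskian`). In the variable `w = σ ^ 2 l` the Airy equation turns the
derivative of `f` into `2 π σ ^ 2 l (W + 2 u' V)` (`hasDerivAt_f`). Hence, at `l = σ a` with
`Ai' a = 0`, the rescaled function `phi l` vanishes at `0` and has there a derivative
`c = 2 π σ ^ 2 W` of modulus `1`; on a fixed disc its derivative stays within `1 / 4` of `c` as soon
as `u' V` is small on the disc of radius `η / |a|` about `a`.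

On such a disc a solution is controlled by its Cauchy data at `a`
(`airy_bound_of_mem_closedBall`). Since `u' a = 0` and `u a * V' a = W`, this reduces the smallness of
`u' V` to `u a * V a → 0` as `a → -∞`. No asymptotic expansion is needed for this: every solution of
the Airy equation tends to `0` along the negative axis, by a Lyapunov function
(`tendsto_zero_of_airy`).

The same decay shows that `Ai'` has zeros arbitrarily far to the left. These zeros are negative,
because `Ai` is bounded on `[0, ∞)`, and simple, because the Wronskian does not vanish. So `aPrime`
does enumerate zeros and tends to `-∞` (`aPrime_mem`, `tendsto_aPrime`).

All three claims follow from the estimate `‖(phi l)' - c‖ ≤ 1 / 4`: on any given disc it holds for all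
large `n`, and on a small enough disc it holds for every `n ≥ 1`, by continuity for the finitely many
remaining ones. A contraction argument then gives existence and uniqueness of the solutions
(`existsUnique_of_norm_deriv_sub_le`).
-/

noncomputable section

namespace ComplexAiry

open MeasureTheory Filter Topology

/-! ### The moments of the cubic exponential -/

/-- The moment `∫ s ^ k exp (-s ^ 3 / 3 - z ω s) ds` over `0 < s < ∞`. For `ω ^ 3 = -1` the
integral `airyRay ω z` is `ω` times the moment with `k = 0`. -/
def rayMoment (k : ℕ) (ω z : ℂ) : ℂ :=
  ∫ s in Ioi (0 : ℝ), (s : ℂ) ^ k * Complex.exp (-(s : ℂ) ^ 3 / 3 - z * ω * s)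

lemma pow_mul_exp_cubic_le (k : ℕ) {R s : ℝ} (hR : 0 ≤ R) (hs : 0 ≤ s) :
    s ^ k * rexp (-s ^ 3 / 3 + R * s) ≤ rexp ((R + k + 1) ^ 3) * rexp (-s) := by
  have h1 : s ^ k ≤ rexp (k * s) := by
    rw [Real.exp_nat_mul]
    exact pow_le_pow_left₀ hs (by linarith [Real.add_one_le_exp s]) k
  calc s ^ k * rexp (-s ^ 3 / 3 + R * s) ≤ rexp (k * s) * rexp (-s ^ 3 / 3 + R * s) := by gcongr
    _ = rexp (-s ^ 3 / 3 + (R + k) * s) := by rw [← Real.exp_add]; ring_nf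
    _ ≤ rexp ((R + k + 1) ^ 3 - s) := by
      apply Real.exp_le_exp.2
      have hk : (0 : ℝ) ≤ k := k.cast_nonneg
      set c := R + k + 1 with hc
      have hc1 : 1 ≤ c := by linarith
      have h2 : 0 ≤ (s - c) ^ 2 * (s + 2 * c) := by positivity
      have h3 : c * s ≤ c ^ 2 * s := by nlinarith [mul_nonneg (by linarith : 0 ≤ c) hs]
      have h4 : 0 ≤ c ^ 3 := by positivity
      have h5 : R + k = c - 1 := by linarith
      rw [h5]
      nlinarith
    _ = _ := by rw [← Real.exp_add]; ring_nf

lemma norm_ray_integrand_le (k : ℕ) {ω z : ℂ} (hω : ‖ω‖ ≤ 1) {R s : ℝ} (hz : ‖z‖ ≤ R)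
    (hs : 0 ≤ s) :
    ‖(s : ℂ) ^ k * Complex.exp (-(s : ℂ) ^ 3 / 3 - z * ω * s)‖
      ≤ rexp ((R + k + 1) ^ 3) * rexp (-s) := by
  have hR : 0 ≤ R := (norm_nonneg z).trans hz
  refine le_trans ?_ (pow_mul_exp_cubic_le k hR hs)
  rw [norm_mul, norm_pow, Complex.norm_real, Real.norm_of_nonneg hs, Complex.norm_exp]
  gcongr
  have h1 : (-(s : ℂ) ^ 3 / 3 - z * ω * s).re = -s ^ 3 / 3 + (-(z * ω * s)).re := by
    have : (-(s : ℂ) ^ 3 / 3 - z * ω * s) = ((-s ^ 3 / 3 : ℝ) : ℂ) + (-(z * ω * s)) := by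
      push_cast; ring
    rw [this, Complex.add_re, Complex.ofReal_re]
  have h2 : (-(z * ω * s)).re ≤ R * s := by
    refine (Complex.re_le_norm _).trans ?_
    rw [norm_neg, norm_mul, norm_mul, Complex.norm_real, Real.norm_of_nonneg hs]
    have : ‖z‖ * ‖ω‖ ≤ R * 1 := mul_le_mul hz hω (norm_nonneg _) hR
    nlinarith
  linarith

lemma integrableOn_const_mul_exp_neg (C : ℝ) :
    IntegrableOn (fun s : ℝ => C * rexp (-s)) (Ioi 0) :=
  (integrableOn_exp_neg_Ioi 0).const_mul C

lemma integrableOn_ray (k : ℕ) {ω : ℂ} (hω : ‖ω‖ ≤ 1) (z : ℂ) :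
    IntegrableOn (fun s : ℝ => (s : ℂ) ^ k * Complex.exp (-(s : ℂ) ^ 3 / 3 - z * ω * s))
      (Ioi 0) := by
  refine Integrable.mono' (integrableOn_const_mul_exp_neg (rexp ((‖z‖ + k + 1) ^ 3))) ?_ ?_
  · exact Continuous.aestronglyMeasurable (by fun_prop)
  · filter_upwards [ae_restrict_mem measurableSet_Ioi] with s hs
    exact norm_ray_integrand_le k hω le_rfl (le_of_lt hs)

lemma hasDerivAt_rayMoment (k : ℕ) {ω : ℂ} (hω : ‖ω‖ ≤ 1) (z : ℂ) :
    HasDerivAt (rayMoment k ω) (-ω * rayMoment (k + 1) ω z) z := by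
  have key := hasDerivAt_integral_of_dominated_loc_of_deriv_le
    (μ := volume.restrict (Ioi (0 : ℝ)))
    (F := fun (x : ℂ) (s : ℝ) => (s : ℂ) ^ k * Complex.exp (-(s : ℂ) ^ 3 / 3 - x * ω * s))
    (F' := fun (x : ℂ) (s : ℝ) =>
      -ω * ((s : ℂ) ^ (k + 1) * Complex.exp (-(s : ℂ) ^ 3 / 3 - x * ω * s)))
    (x₀ := z) (s := Metric.ball z 1)
    (bound := fun s : ℝ => rexp ((‖z‖ + 1 + (k + 1 : ℕ) + 1) ^ 3) * rexp (-s))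
    (Metric.ball_mem_nhds z one_pos) ?_ (integrableOn_ray k hω z) ?_ ?_
    (integrableOn_const_mul_exp_neg _) ?_
  · have h := key.2
    rw [integral_const_mul] at h
    exact h
  · exact Eventually.of_forall fun x => Continuous.aestronglyMeasurable (by fun_prop)
  · exact Continuous.aestronglyMeasurable (by fun_prop)
  · filter_upwards [ae_restrict_mem measurableSet_Ioi] with s hs x hx
    have hx' : ‖x‖ ≤ ‖z‖ + 1 := by
      have := norm_sub_norm_le x z
      have h2 : ‖x - z‖ < 1 := by simpa [dist_eq_norm] using hx
      linarith
    rw [norm_mul, norm_neg]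
    exact (mul_le_of_le_one_left (norm_nonneg _) hω).trans
      (norm_ray_integrand_le (k + 1) hω hx' (le_of_lt hs))
  · refine Eventually.of_forall fun s x _ => ?_
    have h1 : HasDerivAt (fun x : ℂ => -(s : ℂ) ^ 3 / 3 - x * ω * s) (-(ω * s)) x := by
      have := (((hasDerivAt_id x).mul_const ω).mul_const (s : ℂ)).const_sub (-(s : ℂ) ^ 3 / 3)
      simpa using this
    exact (h1.cexp.const_mul ((s : ℂ) ^ k)).congr_deriv (by ring)

/-- The integrand of the combination on the left is minus the derivative of
`exp (-s ^ 3 / 3 - z ω s)`, so that only the boundary value at `0` remains. -/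
lemma rayMoment_two_add (ω : ℂ) (hω : ‖ω‖ ≤ 1) (z : ℂ) :
    rayMoment 2 ω z + z * ω * rayMoment 0 ω z = 1 := by
  have hd : ∀ s : ℝ, HasDerivAt (fun s : ℝ => Complex.exp (-(s : ℂ) ^ 3 / 3 - z * ω * s))
      (-((s : ℂ) ^ 2 * Complex.exp (-(s : ℂ) ^ 3 / 3 - z * ω * s)
        + z * ω * ((s : ℂ) ^ 0 * Complex.exp (-(s : ℂ) ^ 3 / 3 - z * ω * s)))) s := by
    intro s
    have h0 : HasDerivAt (fun s : ℂ => -s ^ 3 / 3 - z * ω * s) (-(s : ℂ) ^ 2 - z * ω) (s : ℂ) := by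
      have := (((hasDerivAt_id (s : ℂ)).pow 3).neg.div_const 3).sub
        ((hasDerivAt_id (s : ℂ)).const_mul (z * ω))
      refine this.congr_deriv ?_
      simp only [id_eq]
      push_cast
      ring
    exact h0.cexp.comp_ofReal.congr_deriv (by ring)
  have hint := (integrableOn_ray 2 hω z).add ((integrableOn_ray 0 hω z).const_mul (z * ω))
  have hlim : Tendsto (fun s : ℝ => Complex.exp (-(s : ℂ) ^ 3 / 3 - z * ω * s)) atTop (𝓝 0) := by
    rw [tendsto_zero_iff_norm_tendsto_zero]
    have hb : Tendsto (fun s : ℝ => rexp ((‖z‖ + (0 : ℕ) + 1) ^ 3) * rexp (-s)) atTop (𝓝 0) := by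
      simpa using (Real.tendsto_exp_neg_atTop_nhds_zero.const_mul
        (rexp ((‖z‖ + (0 : ℕ) + 1) ^ 3)))
    refine tendsto_of_tendsto_of_tendsto_of_le_of_le' tendsto_const_nhds hb
      (Eventually.of_forall fun s => norm_nonneg _) ?_
    filter_upwards [eventually_ge_atTop 0] with s hs
    simpa using norm_ray_integrand_le 0 hω (le_refl ‖z‖) hs
  have hF := integral_Ioi_of_hasDerivAt_of_tendsto (hd 0).continuousAt.continuousWithinAt
    (fun s _ => hd s) hint.neg hlim
  rw [integral_neg, integral_add (integrableOn_ray 2 hω z)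
    ((integrableOn_ray 0 hω z).const_mul (z * ω)), integral_const_mul] at hF
  simp only [Complex.ofReal_zero] at hF
  have : rayMoment 2 ω z + z * ω * rayMoment 0 ω z = 1 := by
    unfold rayMoment
    have h2 := congrArg Neg.neg hF
    rw [neg_neg] at h2
    rw [h2]
    simp
  exact this

/-! ### The Airy function: equation, reality, boundedness, values at the origin -/

/-- The direction `exp (i π / 3)` of the outgoing ray. -/
def rayPlus : ℂ := Complex.exp (Complex.I * (π : ℂ) / 3)

/-- The direction `exp (- i π / 3)` of the incoming ray. -/
def rayMinus : ℂ := Complex.exp (-(Complex.I * (π : ℂ) / 3))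

lemma rayPlus_eq : rayPlus = 1 / 2 + (√3 / 2 : ℝ) * Complex.I := by
  have h : Complex.I * (π : ℂ) / 3 = ((π / 3 : ℝ) : ℂ) * Complex.I := by push_cast; ring
  rw [rayPlus, h, Complex.exp_mul_I, ← Complex.ofReal_cos, ← Complex.ofReal_sin,
    Real.cos_pi_div_three, Real.sin_pi_div_three]
  push_cast
  ring

lemma conj_rayPlus : (starRingEnd ℂ) rayPlus = rayMinus := by
  rw [rayPlus, rayMinus, ← Complex.exp_conj]
  congr 1
  simp only [map_div₀, map_mul, Complex.conj_I, Complex.conj_ofReal, map_ofNat]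
  ring

lemma rayMinus_eq : rayMinus = 1 / 2 - (√3 / 2 : ℝ) * Complex.I := by
  rw [← conj_rayPlus, rayPlus_eq]
  simp only [map_add, map_mul, Complex.conj_I, Complex.conj_ofReal, map_div₀, map_one, map_ofNat]
  ring

lemma sqrt_three_sq : ((√3 : ℝ) : ℂ) ^ 2 = 3 := by
  rw [← Complex.ofReal_pow, Real.sq_sqrt (by norm_num)]
  norm_num

lemma rayPlus_sq : rayPlus ^ 2 = rayPlus - 1 := by
  rw [rayPlus_eq]
  push_cast
  linear_combination (Complex.I ^ 2 / 4) * sqrt_three_sq + 3 / 4 * Complex.I_sq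

lemma rayMinus_sq : rayMinus ^ 2 = rayMinus - 1 := by
  rw [← conj_rayPlus, ← map_pow, rayPlus_sq, map_sub, map_one]

lemma rayPlus_cube : rayPlus ^ 3 = -1 := by
  linear_combination (rayPlus + 1) * rayPlus_sq

lemma rayMinus_cube : rayMinus ^ 3 = -1 := by
  linear_combination (rayMinus + 1) * rayMinus_sq

lemma norm_rayPlus : ‖rayPlus‖ = 1 := by
  have h : Complex.I * (π : ℂ) / 3 = ((π / 3 : ℝ) : ℂ) * Complex.I := by push_cast; ring
  rw [rayPlus, h, Complex.norm_exp_ofReal_mul_I]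

lemma norm_rayMinus : ‖rayMinus‖ = 1 := by
  rw [← conj_rayPlus, Complex.norm_conj, norm_rayPlus]

lemma airyRay_eq {ω : ℂ} (hω : ω ^ 3 = -1) (z : ℂ) : airyRay ω z = ω * rayMoment 0 ω z := by
  rw [airyRay, rayMoment, ← integral_const_mul]
  refine integral_congr_ae (Eventually.of_forall fun s => ?_)
  have : (ω * (s : ℂ)) ^ 3 / 3 - z * (ω * (s : ℂ)) = -(s : ℂ) ^ 3 / 3 - z * ω * s := by
    rw [mul_pow, hω]; ring
  simp only [this]
  ring

lemma airyAi_eq (z : ℂ) : airyAi z = (2 * (π : ℂ) * Complex.I)⁻¹ *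
    (rayPlus * rayMoment 0 rayPlus z - rayMinus * rayMoment 0 rayMinus z) := by
  rw [← airyRay_eq rayPlus_cube, ← airyRay_eq rayMinus_cube]
  rfl

lemma hasDerivAt_airyAi_aux (z : ℂ) : HasDerivAt airyAi ((2 * (π : ℂ) * Complex.I)⁻¹ *
    (rayMinus ^ 2 * rayMoment 1 rayMinus z - rayPlus ^ 2 * rayMoment 1 rayPlus z)) z := by
  rw [funext airyAi_eq]
  refine ((((hasDerivAt_rayMoment 0 norm_rayPlus.le z).const_mul rayPlus).sub
    ((hasDerivAt_rayMoment 0 norm_rayMinus.le z).const_mul rayMinus)).const_mul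
    (2 * (π : ℂ) * Complex.I)⁻¹).congr_deriv ?_
  ring

lemma airyAiDeriv_eq (z : ℂ) : airyAiDeriv z = (2 * (π : ℂ) * Complex.I)⁻¹ *
    (rayMinus ^ 2 * rayMoment 1 rayMinus z - rayPlus ^ 2 * rayMoment 1 rayPlus z) :=
  (hasDerivAt_airyAi_aux z).deriv

lemma hasDerivAt_airyAi (z : ℂ) : HasDerivAt airyAi (airyAiDeriv z) z := by
  rw [airyAiDeriv_eq]
  exact hasDerivAt_airyAi_aux z

/-- The Airy equation `Ai'' = z Ai`. -/
lemma hasDerivAt_airyAiDeriv (z : ℂ) : HasDerivAt airyAiDeriv (z * airyAi z) z := by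
  rw [funext airyAiDeriv_eq]
  refine ((((hasDerivAt_rayMoment 1 norm_rayMinus.le z).const_mul (rayMinus ^ 2)).sub
    ((hasDerivAt_rayMoment 1 norm_rayPlus.le z).const_mul (rayPlus ^ 2))).const_mul
    (2 * (π : ℂ) * Complex.I)⁻¹).congr_deriv ?_
  rw [airyAi_eq]
  have h1 := rayMoment_two_add rayPlus norm_rayPlus.le z
  have h2 := rayMoment_two_add rayMinus norm_rayMinus.le z
  linear_combination (2 * (π : ℂ) * Complex.I)⁻¹ *
    (h2 - h1 - rayMoment 2 rayMinus z * rayMinus_cube + rayMoment 2 rayPlus z * rayPlus_cube)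

lemma rayMoment_conj (k : ℕ) (ω z : ℂ) :
    rayMoment k ((starRingEnd ℂ) ω) ((starRingEnd ℂ) z) = (starRingEnd ℂ) (rayMoment k ω z) := by
  rw [rayMoment, rayMoment, ← integral_conj]
  refine integral_congr_ae (Eventually.of_forall fun s => ?_)
  simp [← Complex.exp_conj, map_ofNat]

lemma airyAi_conj (z : ℂ) : airyAi ((starRingEnd ℂ) z) = (starRingEnd ℂ) (airyAi z) := by
  have h1 := rayMoment_conj 0 rayPlus z
  have h2 := rayMoment_conj 0 rayMinus z
  rw [conj_rayPlus] at h1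
  rw [← conj_rayPlus, Complex.conj_conj] at h2
  rw [airyAi_eq, airyAi_eq, h1, h2, ← conj_rayPlus]
  simp [map_ofNat]
  ring

lemma airyAi_ofReal_im (x : ℝ) : (airyAi x).im = 0 := by
  rw [← Complex.conj_eq_iff_im, ← airyAi_conj, Complex.conj_ofReal]

/-- The imaginary part of a holomorphic function, along the real axis. -/
lemma hasDerivAt_im_ofReal {F : ℂ → ℂ} {F' : ℂ} {x : ℝ} (h : HasDerivAt F F' (x : ℂ)) :
    HasDerivAt (fun y : ℝ => (F y).im) F'.im x := by
  have h1 := (h.const_mul (-Complex.I)).real_of_complex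
  simpa using h1

lemma airyAiDeriv_ofReal_im (x : ℝ) : (airyAiDeriv x).im = 0 := by
  have h2 := hasDerivAt_im_ofReal (hasDerivAt_airyAi x)
  rw [funext airyAi_ofReal_im] at h2
  exact h2.unique (hasDerivAt_const x (0 : ℝ))

lemma norm_rayMoment_le {ω : ℂ} (hω : 0 ≤ ω.re) {x : ℝ} (hx : 0 ≤ x) :
    ‖rayMoment 0 ω x‖ ≤ ∫ s in Ioi (0 : ℝ), rexp 1 * rexp (-s) := by
  refine norm_integral_le_of_norm_le (integrableOn_const_mul_exp_neg _) ?_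
  filter_upwards [ae_restrict_mem measurableSet_Ioi] with s hs
  have hs' : 0 ≤ s := le_of_lt hs
  have h := pow_mul_exp_cubic_le 0 (le_refl 0) hs'
  refine le_trans ?_ (h.trans_eq (by simp))
  rw [pow_zero, pow_zero, one_mul, one_mul, Complex.norm_exp, Real.exp_le_exp]
  have h1 : (-(s : ℂ) ^ 3 / 3 - x * ω * s) = ((-s ^ 3 / 3 : ℝ) : ℂ) - ((x * s : ℝ) : ℂ) * ω := by
    push_cast; ring
  rw [h1, Complex.sub_re, Complex.ofReal_re, Complex.re_ofReal_mul]
  nlinarith [mul_nonneg (mul_nonneg hx hs') hω]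

/-- The Airy function is bounded on `[0, ∞)`, as both rays lie in the right half-plane. -/
lemma exists_norm_airyAi_le : ∃ C : ℝ, ∀ x : ℝ, 0 ≤ x → ‖airyAi x‖ ≤ C := by
  set D := ∫ s in Ioi (0 : ℝ), rexp 1 * rexp (-s)
  refine ⟨‖(2 * (π : ℂ) * Complex.I)⁻¹‖ * (D + D), fun x hx => ?_⟩
  rw [airyAi_eq, norm_mul]
  gcongr
  refine (norm_sub_le _ _).trans (add_le_add ?_ ?_)
  · rw [norm_mul, norm_rayPlus, one_mul]
    exact norm_rayMoment_le (by simp [rayPlus_eq]) hx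
  · rw [norm_mul, norm_rayMinus, one_mul]
    exact norm_rayMoment_le (by simp [rayMinus_eq]) hx

lemma rayMoment_zero (k : ℕ) (ω : ℂ) : rayMoment k ω 0 =
    (((1 / 3 : ℝ) ^ (-((k : ℝ) + 1) / 3) * (1 / 3) * Real.Gamma (((k : ℝ) + 1) / 3) : ℝ) : ℂ) := by
  have h := integral_rpow_mul_exp_neg_mul_rpow (p := 3) (q := k) (b := 1 / 3) (by norm_num)
    (by have : (0 : ℝ) ≤ k := k.cast_nonneg
        linarith) (by norm_num)
  rw [← h, ← integral_complex_ofReal, rayMoment]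
  refine setIntegral_congr_fun measurableSet_Ioi fun s hs => ?_
  have e : s ^ (3 : ℝ) = s ^ 3 := by exact_mod_cast Real.rpow_natCast s 3
  simp only [Real.rpow_natCast, e]
  push_cast
  congr 2
  ring

/-- The product of `Ai 0` and `Ai' 0`, by the reflection formula for `Γ`. -/
lemma airyAi_zero_mul_airyAiDeriv_zero :
    airyAi 0 * airyAiDeriv 0 = ((-(1 / (2 * π * √3)) : ℝ) : ℂ) := by
  rw [airyAi_eq, airyAiDeriv_eq, rayMoment_zero, rayMoment_zero, rayMoment_zero, rayMoment_zero,
    rayPlus_sq, rayMinus_sq]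
  set A : ℝ := (1 / 3 : ℝ) ^ (-(((0 : ℕ) : ℝ) + 1) / 3) * (1 / 3) *
    Real.Gamma ((((0 : ℕ) : ℝ) + 1) / 3) with hA
  set B : ℝ := (1 / 3 : ℝ) ^ (-(((1 : ℕ) : ℝ) + 1) / 3) * (1 / 3) *
    Real.Gamma ((((1 : ℕ) : ℝ) + 1) / 3) with hB
  have hAB : A * B = 2 * π / (3 * √3) := by
    have h1 := Real.Gamma_mul_Gamma_one_sub (1 / 3)
    have h2 : (1 / 3 : ℝ) ^ (-(((0 : ℕ) : ℝ) + 1) / 3) * (1 / 3 : ℝ) ^ (-(((1 : ℕ) : ℝ) + 1) / 3)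
        = 3 := by
      rw [← Real.rpow_add (by norm_num)]
      norm_num
    have h3 : Real.Gamma ((((0 : ℕ) : ℝ) + 1) / 3) * Real.Gamma ((((1 : ℕ) : ℝ) + 1) / 3)
        = 2 * π / √3 := by
      have e1 : (((0 : ℕ) : ℝ) + 1) / 3 = 1 / 3 := by norm_num
      have e2 : (((1 : ℕ) : ℝ) + 1) / 3 = 1 - 1 / 3 := by norm_num
      have e3 : π * (1 / 3) = π / 3 := by ring
      rw [e1, e2, h1, e3, Real.sin_pi_div_three]
      field_simp
    calc A * B = ((1 / 3 : ℝ) ^ (-(((0 : ℕ) : ℝ) + 1) / 3) *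
          (1 / 3 : ℝ) ^ (-(((1 : ℕ) : ℝ) + 1) / 3)) * (1 / 9) *
          (Real.Gamma ((((0 : ℕ) : ℝ) + 1) / 3) * Real.Gamma ((((1 : ℕ) : ℝ) + 1) / 3)) := by
          rw [hA, hB]; ring
      _ = _ := by rw [h2, h3]; ring
  have hs : (√3 : ℝ) ≠ 0 := by positivity
  have hsC : ((√3 : ℝ) : ℂ) ≠ 0 := by exact_mod_cast hs
  have hpi : (π : ℂ) ≠ 0 := by exact_mod_cast Real.pi_ne_zero
  have hABC : (A : ℂ) * B = 2 * π / (3 * (√3 : ℝ)) := by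
    rw [← Complex.ofReal_mul, hAB]; push_cast; ring
  rw [rayPlus_eq, rayMinus_eq]
  have : (2 * (π : ℂ) * Complex.I)⁻¹ * ((1 / 2 + (√3 / 2 : ℝ) * Complex.I) * (A : ℂ)
      - (1 / 2 - (√3 / 2 : ℝ) * Complex.I) * (A : ℂ)) * ((2 * (π : ℂ) * Complex.I)⁻¹ *
      ((1 / 2 - (√3 / 2 : ℝ) * Complex.I - 1) * (B : ℂ)
      - (1 / 2 + (√3 / 2 : ℝ) * Complex.I - 1) * (B : ℂ)))
      = -((2 * (π : ℂ))⁻¹) ^ 2 * ((√3 : ℝ) : ℂ) ^ 2 * ((A : ℂ) * B) := by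
    have hI := Complex.I_ne_zero
    push_cast
    field_simp
    ring
  rw [this, hABC, sqrt_three_sq]
  push_cast
  field_simp

/-! ### Real solutions of the Airy equation on the oscillatory half-line -/

/-- Every real solution of `y'' = - t y` tends to `0` as `t → ∞`. The energy
`y ^ 2 + y' ^ 2 / t`, corrected by `y y' / (2 t ^ 2)`, is a Lyapunov function `K` with
`K' ≤ - K / (8 t)`, so that `t K ^ 8` is nonincreasing. -/
theorem tendsto_zero_of_airy {y y' : ℝ → ℝ} (hy : ∀ t, HasDerivAt y (y' t) t)
    (hy' : ∀ t, HasDerivAt y' (-t * y t) t) : Tendsto y atTop (𝓝 0) := by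
  set K : ℝ → ℝ := fun t => y t ^ 2 + y' t ^ 2 * t⁻¹ + y t * y' t * t⁻¹ ^ 2 / 2 with hK
  have hKd : ∀ t, 0 < t → HasDerivAt K
      (-(y' t ^ 2 * t⁻¹ ^ 2 + y t ^ 2 * t⁻¹) / 2 - y t * y' t * t⁻¹ ^ 3) t := by
    intro t ht
    have hi := hasDerivAt_inv ht.ne'
    refine ((((hy t).pow 2).add (((hy' t).pow 2).mul hi)).add
      ((((hy t).mul (hy' t)).mul (hi.pow 2)).div_const 2)).congr_deriv ?_
    simp only [Pi.pow_apply, Pi.mul_apply]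
    push_cast
    field_simp
    ring
  -- The cross terms are dominated by the energy as soon as `t ≥ 2`.
  have hcross : ∀ t, 2 ≤ t → |y t * y' t * t⁻¹ ^ 2| ≤ (y t ^ 2 + y' t ^ 2 * t⁻¹) / 4 := by
    intro t ht
    have hr0 : 0 < t⁻¹ := by positivity
    have hr : t⁻¹ ≤ 1 / 2 := by
      rw [one_div]; exact inv_anti₀ (by norm_num) ht
    set r := t⁻¹
    have h1 : |y t * y' t * r ^ 2| ≤ r * ((y t ^ 2 + y' t ^ 2 * r ^ 2) / 2) := by
      rw [abs_le]
      constructor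
      · nlinarith [mul_nonneg hr0.le (sq_nonneg (y t + y' t * r))]
      · nlinarith [mul_nonneg hr0.le (sq_nonneg (y t - y' t * r))]
    have h2 : y' t ^ 2 * r ^ 2 ≤ y' t ^ 2 * r := by
      have : r ^ 2 ≤ r := by nlinarith
      exact mul_le_mul_of_nonneg_left this (sq_nonneg _)
    have h3 : 0 ≤ (y t ^ 2 + y' t ^ 2 * r ^ 2) / 2 := by positivity
    nlinarith
  have hyK : ∀ t, 2 ≤ t → y t ^ 2 ≤ 2 * K t := by
    intro t ht
    have h1 := (abs_le.1 (hcross t ht)).1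
    have h2 : 0 ≤ y' t ^ 2 * t⁻¹ := by positivity
    simp only [hK]
    nlinarith [sq_nonneg (y t)]
  have hanti : AntitoneOn (fun t => t * K t ^ 8) (Ici 2) := by
    have hd : ∀ t, 2 ≤ t → HasDerivAt (fun t => t * K t ^ 8)
        (K t ^ 7 * (K t + 8 * t * (-(y' t ^ 2 * t⁻¹ ^ 2 + y t ^ 2 * t⁻¹) / 2
          - y t * y' t * t⁻¹ ^ 3))) t := by
      intro t ht
      refine ((hasDerivAt_id t).mul ((hKd t (by linarith)).pow 8)).congr_deriv ?_
      simp only [id_eq, Pi.pow_apply]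
      push_cast
      ring
    refine antitoneOn_of_hasDerivWithinAt_nonpos (convex_Ici 2)
      (fun t ht => (hd t ht).continuousAt.continuousWithinAt)
      (fun t ht => (hd t (interior_subset ht)).hasDerivWithinAt) fun t ht => ?_
    have ht2 : (2 : ℝ) ≤ t := interior_subset ht
    have hKt : 0 ≤ K t := by nlinarith [hyK t ht2, sq_nonneg (y t)]
    refine mul_nonpos_of_nonneg_of_nonpos (by positivity) ?_
    have e : K t + 8 * t * (-(y' t ^ 2 * t⁻¹ ^ 2 + y t ^ 2 * t⁻¹) / 2 - y t * y' t * t⁻¹ ^ 3)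
        = -3 * (y t ^ 2 + y' t ^ 2 * t⁻¹) - 15 / 2 * (y t * y' t * t⁻¹ ^ 2) := by
      simp only [hK]
      field_simp
      ring
    rw [e]
    have h1 := (abs_le.1 (hcross t ht2)).1
    have h2 : 0 ≤ y' t ^ 2 * t⁻¹ := by positivity
    nlinarith [sq_nonneg (y t)]
  have hbound : ∀ t, 2 ≤ t → y t ^ 16 ≤ 2 ^ 8 * (2 * K 2 ^ 8) * t⁻¹ := by
    intro t ht
    have h1 : t * K t ^ 8 ≤ 2 * K 2 ^ 8 := hanti (by simp) ht ht
    have h2 : (y t ^ 2) ^ 8 ≤ (2 * K t) ^ 8 := pow_le_pow_left₀ (sq_nonneg _) (hyK t ht) 8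
    have h3 : K t ^ 8 ≤ 2 * K 2 ^ 8 * t⁻¹ := by
      rw [← div_eq_mul_inv, le_div_iff₀ (by linarith)]; linarith
    calc y t ^ 16 = (y t ^ 2) ^ 8 := by ring
      _ ≤ 2 ^ 8 * K t ^ 8 := h2.trans_eq (by ring)
      _ ≤ 2 ^ 8 * (2 * K 2 ^ 8 * t⁻¹) := by gcongr
      _ = _ := by ring
  have hlim : Tendsto (fun t => 2 ^ 8 * (2 * K 2 ^ 8) * t⁻¹) atTop (𝓝 0) := by
    simpa using (tendsto_inv_atTop_zero (𝕜 := ℝ)).const_mul (2 ^ 8 * (2 * K 2 ^ 8))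
  rw [Metric.tendsto_nhds]
  intro ε hε
  filter_upwards [eventually_ge_atTop 2, hlim.eventually_lt_const (pow_pos hε 16)] with t h2 h3
  rw [dist_zero_right, Real.norm_eq_abs]
  refine lt_of_pow_lt_pow_left₀ 16 hε.le ?_
  rw [Even.pow_abs (by decide)]
  exact (hbound t h2).trans_lt h3

lemma not_forall_deriv_pos_of_airy {y y' : ℝ → ℝ} (hy : ∀ t, HasDerivAt y (y' t) t)
    (hy' : ∀ t, HasDerivAt y' (-t * y t) t) {T : ℝ} (hT : 0 ≤ T) : ¬ ∀ t, T < t → 0 < y' t := by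
  intro hpos
  have hmono : StrictMonoOn y (Ioi T) := by
    refine strictMonoOn_of_hasDerivWithinAt_pos (convex_Ioi T)
      (fun t _ => (hy t).continuousAt.continuousWithinAt)
      (fun t _ => (hy t).hasDerivWithinAt) fun t ht => hpos t (interior_subset ht)
  -- An increasing function with limit `0` is negative, so that `y'' = - t y` is positive.
  have hneg : ∀ t, T < t → y t < 0 := by
    intro t ht
    have h1 : y t < y (t + 1) := hmono ht (by simp only [mem_Ioi]; linarith) (by linarith)
    refine h1.trans_le (ge_of_tendsto (tendsto_zero_of_airy hy hy') ?_)
    filter_upwards [eventually_gt_atTop (t + 1)] with s hs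
    exact (hmono (by simp only [mem_Ioi]; linarith) (by simp only [mem_Ioi]; linarith) hs).le
  have hmono' : MonotoneOn y' (Ioi T) := by
    refine monotoneOn_of_hasDerivWithinAt_nonneg (convex_Ioi T)
      (fun t _ => (hy' t).continuousAt.continuousWithinAt)
      (fun t _ => (hy' t).hasDerivWithinAt) fun t ht => ?_
    have ht' : T < t := interior_subset ht
    nlinarith [hneg t ht']
  set c := y' (T + 1) with hc
  have hc0 : 0 < c := hpos _ (by linarith)
  have hmono2 : MonotoneOn (fun t => y t - c * t) (Ici (T + 1)) := by
    have hd : ∀ t, HasDerivAt (fun t => y t - c * t) (y' t - c * 1) t := fun t =>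
      (hy t).sub ((hasDerivAt_id t).const_mul c)
    refine monotoneOn_of_hasDerivWithinAt_nonneg (convex_Ici _)
      (fun t _ => (hd t).continuousAt.continuousWithinAt)
      (fun t _ => (hd t).hasDerivWithinAt) fun t ht => ?_
    have ht' : T + 1 ≤ t := interior_subset ht
    have := hmono' (a := T + 1) (b := t) (by simp) (by simp only [mem_Ioi]; linarith) ht'
    linarith
  set t := T + 1 + |y (T + 1)| / c with ht
  have htT : T + 1 ≤ t := by
    have : 0 ≤ |y (T + 1)| / c := by positivity
    linarith
  have h1 := hmono2 (a := T + 1) (b := t) (by simp) htT htT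
  have h2 : c * t = c * (T + 1) + |y (T + 1)| := by
    rw [ht]; field_simp
  simp only at h1
  have h3 := hneg t (by linarith)
  have h4 := neg_abs_le (y (T + 1))
  linarith

/-- The derivative of a real solution of `y'' = - t y` has arbitrarily large zeros. -/
theorem exists_deriv_eq_zero_of_airy {y y' : ℝ → ℝ} (hy : ∀ t, HasDerivAt y (y' t) t)
    (hy' : ∀ t, HasDerivAt y' (-t * y t) t) (T : ℝ) : ∃ t, T < t ∧ y' t = 0 := by
  by_contra! hne
  set S := max T 0
  have hS : ∀ t, S < t → y' t ≠ 0 := fun t ht => hne t ((le_max_left _ _).trans_lt ht)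
  have hcont : ContinuousOn y' (Ioi S) := fun t _ => (hy' t).continuousAt.continuousWithinAt
  have hsign : (∀ t, S < t → 0 < y' t) ∨ ∀ t, S < t → y' t < 0 := by
    by_contra! h
    obtain ⟨⟨a, ha, ha'⟩, b, hb, hb'⟩ := h
    obtain ⟨c, hc, hc'⟩ := isPreconnected_Ioi.intermediate_value ha hb hcont ⟨ha', hb'⟩
    exact hS c hc hc'
  rcases hsign with h | h
  · exact not_forall_deriv_pos_of_airy hy hy' (le_max_right _ _) h
  · refine not_forall_deriv_pos_of_airy (y := fun t => -y t) (y' := fun t => -y' t)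
      (fun t => (hy t).neg) (fun t => (hy' t).neg.congr_deriv (by ring)) (le_max_right T 0)
      fun t ht => by linarith [h t ht]

/-! ### The Wronskian and the zeros of the derivative -/

lemma airyAi_zero_mul_airyAiDeriv_zero_ne : airyAi 0 * airyAiDeriv 0 ≠ 0 := by
  rw [airyAi_zero_mul_airyAiDeriv_zero, Complex.ofReal_ne_zero, neg_ne_zero]
  positivity

/-- The Wronskian of the two solutions `Ai w` and `Ai (τ w)` of the Airy equation, `τ ^ 3 = 1`. It
is constant, and is evaluated at `0`. -/
theorem wronskian_airyAi {τ : ℂ} (hτ : τ ^ 3 = 1) (w : ℂ) :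
    airyAi w * (τ * airyAiDeriv (τ * w)) - airyAiDeriv w * airyAi (τ * w)
      = (τ - 1) * (airyAi 0 * airyAiDeriv 0) := by
  have hd : ∀ w : ℂ, HasDerivAt (fun w => airyAi w * (τ * airyAiDeriv (τ * w))
      - airyAiDeriv w * airyAi (τ * w)) 0 w := by
    intro w
    have hm : HasDerivAt (fun w : ℂ => τ * w) τ w := by
      simpa using (hasDerivAt_id w).const_mul τ
    have h1 : HasDerivAt (fun w => airyAi (τ * w)) (airyAiDeriv (τ * w) * τ) w :=
      (hasDerivAt_airyAi (τ * w)).comp w hm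
    have h2 : HasDerivAt (fun w => airyAiDeriv (τ * w)) (τ * w * airyAi (τ * w) * τ) w :=
      (hasDerivAt_airyAiDeriv (τ * w)).comp w hm
    refine (((hasDerivAt_airyAi w).mul (h2.const_mul τ)).sub
      ((hasDerivAt_airyAiDeriv w).mul h1)).congr_deriv ?_
    linear_combination (airyAi w * w * airyAi (τ * w)) * hτ
  have h := is_const_of_deriv_eq_zero (fun w => (hd w).differentiableAt)
    (fun w => (hd w).deriv) w 0
  simp only [mul_zero] at h
  rw [h]
  ring

lemma airyAi_ne_zero_of_deriv_eq_zero {w : ℂ} (h : airyAiDeriv w = 0) : airyAi w ≠ 0 := by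
  intro h0
  have hτ : (rayPlus ^ 2) ^ 3 = 1 := by
    rw [← pow_mul, mul_comm, pow_mul, rayPlus_cube]; norm_num
  have hW := wronskian_airyAi hτ w
  rw [h, h0, zero_mul, zero_mul, sub_zero, eq_comm, mul_eq_zero] at hW
  refine hW.elim (fun h1 => ?_) airyAi_zero_mul_airyAiDeriv_zero_ne
  have := congrArg Complex.re h1
  rw [rayPlus_sq, rayPlus_eq] at this
  norm_num at this

lemma hasDerivAt_airyAi_re (x : ℝ) :
    HasDerivAt (fun x : ℝ => (airyAi x).re) (airyAiDeriv x).re x :=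
  (hasDerivAt_airyAi x).real_of_complex

lemma hasDerivAt_airyAiDeriv_re (x : ℝ) :
    HasDerivAt (fun x : ℝ => (airyAiDeriv x).re) (x * (airyAi x).re) x :=
  (hasDerivAt_airyAiDeriv x).real_of_complex.congr_deriv (Complex.re_ofReal_mul _ _)

lemma mem_airyAiDerivZeros {x : ℝ} : x ∈ airyAiDerivZeros ↔ (airyAiDeriv x).re = 0 :=
  ⟨fun h => by rw [show airyAiDeriv x = 0 from h, Complex.zero_re],
    fun h => Complex.ext h (airyAiDeriv_ofReal_im x)⟩

lemma isClosed_airyAiDerivZeros : IsClosed airyAiDerivZeros := by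
  have hc : Continuous fun x : ℝ => airyAiDeriv x :=
    (Differentiable.continuous fun z => (hasDerivAt_airyAiDeriv z).differentiableAt).comp
      Complex.continuous_ofReal
  exact isClosed_singleton.preimage hc

/-- If `Ai'` vanished at some `x ≥ 0`, then `Ai Ai'` would increase from `0` on `[x, ∞)`, and
`Ai ^ 2` would be unbounded there. -/
theorem neg_of_mem_airyAiDerivZeros {x : ℝ} (hx : x ∈ airyAiDerivZeros) : x < 0 := by
  by_contra! hx0
  set y : ℝ → ℝ := fun x => (airyAi x).re with hy
  set y' : ℝ → ℝ := fun x => (airyAiDeriv x).re with hy'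
  have hyx : y' x = 0 := mem_airyAiDerivZeros.1 hx
  have hPd : ∀ s, HasDerivAt (fun s => y s * y' s) (y' s ^ 2 + s * y s ^ 2) s := fun s =>
    ((hasDerivAt_airyAi_re s).mul (hasDerivAt_airyAiDeriv_re s)).congr_deriv (by
      simp only [hy, hy']; ring)
  have hP : StrictMonoOn (fun s => y s * y' s) (Ici x) := by
    refine strictMonoOn_of_hasDerivWithinAt_pos (convex_Ici x)
      (fun s _ => (hPd s).continuousAt.continuousWithinAt)
      (fun s _ => (hPd s).hasDerivWithinAt) fun s hs => ?_
    rw [interior_Ici] at hs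
    have hs0 : 0 < s := hx0.trans_lt hs
    by_cases h : y' s = 0
    · have h1 : airyAi s ≠ 0 := airyAi_ne_zero_of_deriv_eq_zero (mem_airyAiDerivZeros.2 h)
      have h2 : y s ≠ 0 := fun h3 => h1 (Complex.ext h3 (airyAi_ofReal_im s))
      positivity
    · positivity
  set c := y (x + 1) * y' (x + 1)
  have hc : 0 < c := by
    have h1 := hP (a := x) (b := x + 1) (by simp) (by simp) (by linarith)
    simp only [hyx, mul_zero] at h1
    exact h1
  have hQ : MonotoneOn (fun s => y s ^ 2 - 2 * c * s) (Ici (x + 1)) := by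
    have hd : ∀ s, HasDerivAt (fun s => y s ^ 2 - 2 * c * s) (2 * (y s * y' s) - 2 * c) s := fun s =>
      (((hasDerivAt_airyAi_re s).pow 2).sub ((hasDerivAt_id s).const_mul (2 * c))).congr_deriv (by
        simp only [hy, hy']; push_cast; ring)
    refine monotoneOn_of_hasDerivWithinAt_nonneg (convex_Ici _)
      (fun s _ => (hd s).continuousAt.continuousWithinAt)
      (fun s _ => (hd s).hasDerivWithinAt) fun s hs => ?_
    have hs' : x + 1 ≤ s := interior_subset hs
    have : c ≤ y s * y' s := hP.monotoneOn (a := x + 1) (b := s) (by simp)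
      (by simp only [mem_Ici]; linarith) hs'
    linarith
  obtain ⟨C, hC⟩ := exists_norm_airyAi_le
  have hbound : ∀ s, 0 ≤ s → y s ^ 2 ≤ C ^ 2 := fun s hs =>
    sq_le_sq' (neg_le_of_neg_le ((neg_le_abs _).trans ((Complex.abs_re_le_norm _).trans (hC s hs))))
      ((le_abs_self _).trans ((Complex.abs_re_le_norm _).trans (hC s hs)))
  set s := x + 1 + (C ^ 2 + 1) / (2 * c) with hs
  have hsx : x + 1 ≤ s := by
    have : 0 ≤ (C ^ 2 + 1) / (2 * c) := by positivity
    linarith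
  have h1 := hQ (a := x + 1) (b := s) (by simp) hsx hsx
  have h2 : 2 * c * s = 2 * c * (x + 1) + (C ^ 2 + 1) := by
    rw [hs]; field_simp
  simp only at h1
  have h3 := hbound s (by linarith)
  nlinarith [sq_nonneg (y (x + 1))]

/-- The zeros of `Ai'` are simple, hence isolated. -/
lemma eventually_notMem_airyAiDerivZeros {a : ℝ} (ha : a ∈ airyAiDerivZeros) :
    ∀ᶠ x in 𝓝[≠] a, x ∉ airyAiDerivZeros := by
  have hd := (hasDerivAt_airyAiDeriv a).comp_ofReal
  have ha0 : (a : ℂ) ≠ 0 := Complex.ofReal_ne_zero.2 (neg_of_mem_airyAiDerivZeros ha).ne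
  exact hd.eventually_ne (mul_ne_zero ha0 (airyAi_ne_zero_of_deriv_eq_zero ha))

lemma hasDerivAt_comp_neg {g : ℝ → ℝ} {g' t : ℝ} (h : HasDerivAt g g' (-t)) :
    HasDerivAt (fun t => g (-t)) (-g') t := by
  exact (h.comp t (hasDerivAt_neg t)).congr_deriv (by ring)

lemma exists_mem_airyAiDerivZeros_lt (b : ℝ) : ∃ x ∈ airyAiDerivZeros, x < b := by
  obtain ⟨t, ht, h0⟩ := exists_deriv_eq_zero_of_airy
    (y := fun t => (airyAi ((-t : ℝ) : ℂ)).re) (y' := fun t => -(airyAiDeriv ((-t : ℝ) : ℂ)).re)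
    (fun t => hasDerivAt_comp_neg (hasDerivAt_airyAi_re (-t)))
    (fun t => (hasDerivAt_comp_neg (hasDerivAt_airyAiDeriv_re (-t))).neg.congr_deriv (by ring)) (-b)
  exact ⟨-t, mem_airyAiDerivZeros.2 (neg_eq_zero.1 h0), by linarith⟩

lemma aPrime_one_mem : aPrime 1 ∈ airyAiDerivZeros := by
  obtain ⟨x, hx, -⟩ := exists_mem_airyAiDerivZeros_lt 0
  exact isClosed_airyAiDerivZeros.csSup_mem ⟨x, hx⟩
    ⟨0, fun x hx => (neg_of_mem_airyAiDerivZeros hx).le⟩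

lemma aPrime_succ_mem {n : ℕ} (h : aPrime (n + 1) ∈ airyAiDerivZeros) :
    aPrime (n + 2) ∈ airyAiDerivZeros ∧ aPrime (n + 2) < aPrime (n + 1) := by
  set b := aPrime (n + 1)
  set S : Set ℝ := {x : ℝ | x ∈ airyAiDerivZeros ∧ x < b} with hS
  have hSup : aPrime (n + 2) = sSup S := by rw [aPrime]
  obtain ⟨x, hx, hxb⟩ := exists_mem_airyAiDerivZeros_lt b
  have hne : S.Nonempty := ⟨x, hx, hxb⟩
  have hmem : sSup S ∈ closure S := csSup_mem_closure hne ⟨b, fun x hx => hx.2.le⟩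
  rw [hSup]
  refine ⟨isClosed_airyAiDerivZeros.closure_subset_iff.2 (fun x hx => hx.1) hmem,
    lt_of_le_of_ne (csSup_le hne fun x hx => hx.2.le) fun he => ?_⟩
  rw [he, mem_closure_iff_frequently] at hmem
  refine hmem ?_
  filter_upwards [eventually_nhdsWithin_iff.1 (eventually_notMem_airyAiDerivZeros h)] with x hx hxS
  exact hx hxS.2.ne hxS.1

lemma aPrime_mem (n : ℕ) : aPrime (n + 1) ∈ airyAiDerivZeros := by
  induction n with
  | zero => exact aPrime_one_mem
  | succ n ih => exact (aPrime_succ_mem ih).1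

lemma tendsto_aPrime : Tendsto aPrime atTop atBot := by
  rw [← tendsto_add_atTop_iff_nat 1]
  have hanti : StrictAnti fun n => aPrime (n + 1) :=
    strictAnti_nat_of_succ_lt fun n => (aPrime_succ_mem (aPrime_mem n)).2
  refine (tendsto_atTop_of_antitone hanti.antitone).resolve_right ?_
  rintro ⟨l, hl⟩
  have hlZ : l ∈ airyAiDerivZeros :=
    isClosed_airyAiDerivZeros.mem_of_tendsto hl (Eventually.of_forall aPrime_mem)
  have hl' : Tendsto (fun n => aPrime (n + 1)) atTop (𝓝[≠] l) := by
    refine tendsto_nhdsWithin_iff.2 ⟨hl, Eventually.of_forall fun n => ?_⟩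
    exact ((hanti.antitone.le_of_tendsto hl (n + 1)).trans_lt (hanti n.lt_succ_self)).ne'
  obtain ⟨n, hn⟩ := (hl'.eventually (eventually_notMem_airyAiDerivZeros hlZ)).exists
  exact hn (aPrime_mem n)

/-! ### Complex solutions of the Airy equation near the negative axis -/

lemma tendsto_airy_atBot {F F' : ℂ → ℂ} (hF : ∀ z, HasDerivAt F (F' z) z)
    (hF' : ∀ z, HasDerivAt F' (z * F z) z) : Tendsto (fun x : ℝ => F x) atBot (𝓝 0) := by
  have hre : Tendsto (fun t : ℝ => (F ((-t : ℝ) : ℂ)).re) atTop (𝓝 0) :=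
    tendsto_zero_of_airy (y' := fun t => -(F' ((-t : ℝ) : ℂ)).re)
      (fun t => hasDerivAt_comp_neg (hF _).real_of_complex)
      fun t => ((hasDerivAt_comp_neg (hF' _).real_of_complex).neg).congr_deriv (by
        rw [Complex.re_ofReal_mul]; ring)
  have him : Tendsto (fun t : ℝ => (F ((-t : ℝ) : ℂ)).im) atTop (𝓝 0) :=
    tendsto_zero_of_airy (y' := fun t => -(F' ((-t : ℝ) : ℂ)).im)
      (fun t => hasDerivAt_comp_neg (hasDerivAt_im_ofReal (hF _)))
      fun t => ((hasDerivAt_comp_neg (hasDerivAt_im_ofReal (hF' _))).neg).congr_deriv (by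
        rw [Complex.im_ofReal_mul]; ring)
  have h1 : Tendsto (fun t : ℝ => F ((-t : ℝ) : ℂ)) atTop (𝓝 0) := by
    have h2 := (Complex.continuous_ofReal.tendsto 0).comp hre
    have h3 := ((Complex.continuous_ofReal.tendsto 0).comp him).mul_const Complex.I
    have h4 := h2.add h3
    simp only [Complex.ofReal_zero, zero_mul, add_zero] at h4
    refine h4.congr fun t => ?_
    exact Complex.re_add_im _
  refine (h1.comp tendsto_neg_atBot_atTop).congr fun x => ?_
  simp

/-- A solution of the Airy equation on a disc that is small compared with the length scale of the
equation is controlled by its Cauchy data at the centre. -/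
theorem airy_bound_of_mem_closedBall {F F' : ℂ → ℂ} (hF : ∀ z, HasDerivAt F (F' z) z)
    (hF' : ∀ z, HasDerivAt F' (z * F z) z) {a : ℂ} {r B : ℝ}
    (hB : ∀ z ∈ Metric.closedBall a r, ‖z‖ ≤ B) (hBr : B * r ^ 2 ≤ 1 / 2) {z : ℂ}
    (hz : z ∈ Metric.closedBall a r) :
    ‖F z‖ ≤ 2 * (‖F a‖ + r * ‖F' a‖) ∧
      ‖F' z‖ ≤ ‖F' a‖ + 2 * B * r * (‖F a‖ + r * ‖F' a‖) := by
  have hr : 0 ≤ r := Metric.nonempty_closedBall.1 ⟨z, hz⟩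
  have ha : a ∈ Metric.closedBall a r := Metric.mem_closedBall_self hr
  have hB0 : 0 ≤ B := (norm_nonneg a).trans (hB a ha)
  have hconv := convex_closedBall a r
  have hcF : Continuous F := Differentiable.continuous fun z => (hF z).differentiableAt
  -- `F` and `F'` are bounded in terms of the maximum of `F`, which is then absorbed by `B r ^ 2 ≤ 1 / 2`.
  obtain ⟨m, hm, hmax⟩ := (isCompact_closedBall a r).exists_isMaxOn ⟨a, ha⟩ hcF.norm.continuousOn
  set M := ‖F m‖
  have hM : ∀ w ∈ Metric.closedBall a r, ‖F w‖ ≤ M := fun w hw => hmax hw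
  have hdist : ∀ w ∈ Metric.closedBall a r, ‖w - a‖ ≤ r := fun w hw => by
    simpa [dist_eq_norm] using hw
  have hF'le : ∀ w ∈ Metric.closedBall a r, ‖F' w‖ ≤ ‖F' a‖ + B * M * r := by
    intro w hw
    have h1 := hconv.norm_image_sub_le_of_norm_hasDerivWithin_le (C := B * M)
      (fun z _ => (hF' z).hasDerivWithinAt)
      (fun z hz => by
        rw [norm_mul]
        exact mul_le_mul (hB z hz) (hM z hz) (norm_nonneg _) hB0) ha hw
    have h2 : B * M * ‖w - a‖ ≤ B * M * r :=
      mul_le_mul_of_nonneg_left (hdist w hw) (mul_nonneg hB0 (norm_nonneg _))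
    have h3 := norm_sub_norm_le (F' w) (F' a)
    linarith
  have hFle : ∀ w ∈ Metric.closedBall a r, ‖F w‖ ≤ ‖F a‖ + (‖F' a‖ + B * M * r) * r := by
    intro w hw
    have h1 := hconv.norm_image_sub_le_of_norm_hasDerivWithin_le
      (fun z _ => (hF z).hasDerivWithinAt) hF'le ha hw
    have h0 : 0 ≤ ‖F' a‖ + B * M * r := by positivity
    have h2 := mul_le_mul_of_nonneg_left (hdist w hw) h0
    have h3 := norm_sub_norm_le (F w) (F a)
    linarith
  have hMle : M ≤ 2 * (‖F a‖ + r * ‖F' a‖) := by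
    have h1 := hFle m hm
    have h2 : B * r ^ 2 * M ≤ 1 / 2 * M := mul_le_mul_of_nonneg_right hBr (norm_nonneg _)
    have h3 : ‖F m‖ = M := rfl
    nlinarith
  refine ⟨(hM z hz).trans hMle, (hF'le z hz).trans ?_⟩
  have : B * r * M ≤ B * r * (2 * (‖F a‖ + r * ‖F' a‖)) := by gcongr
  linarith

section Phase

/-! Here `σ` stands for a primitive cube root of unity, that is, for one of `exp (± i α)`. -/

variable {σ : ℂ}

lemma phase_cube (hσ : σ ^ 2 + σ + 1 = 0) : σ ^ 3 = 1 := by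
  linear_combination (σ - 1) * hσ

lemma phase_norm (hσ : σ ^ 2 + σ + 1 = 0) : ‖σ‖ = 1 :=
  Complex.norm_eq_one_of_pow_eq_one (phase_cube hσ) (by norm_num)

lemma phase_sq_norm_sub_one (hσ : σ ^ 2 + σ + 1 = 0) : ‖σ ^ 2 - 1‖ = √3 := by
  have h3 := phase_cube hσ
  have hc : σ * (starRingEnd ℂ) σ = 1 := by
    rw [Complex.mul_conj, Complex.normSq_eq_norm_sq, phase_norm hσ]; norm_num
  have hc2 : (starRingEnd ℂ) σ = σ ^ 2 := by
    linear_combination σ ^ 2 * hc - (starRingEnd ℂ) σ * h3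
  have h : ((‖σ ^ 2 - 1‖ ^ 2 : ℝ) : ℂ) = ((3 : ℝ) : ℂ) := by
    rw [← Complex.normSq_eq_norm_sq, ← Complex.mul_conj, map_sub, map_pow, map_one, hc2]
    push_cast
    linear_combination (σ ^ 3 - σ + 1) * h3 - hσ
  rw [← Complex.ofReal_injective h, Real.sqrt_sq (norm_nonneg _)]

lemma exp_alpha_eq : Complex.exp (Complex.I * (alpha : ℂ)) = rayPlus ^ 2 := by
  rw [rayPlus, ← Complex.exp_nat_mul, alpha]
  congr 1
  push_cast
  ring

lemma exp_neg_alpha_eq : Complex.exp (-(Complex.I * (alpha : ℂ))) = rayMinus ^ 2 := by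
  rw [rayMinus, ← Complex.exp_nat_mul, alpha]
  congr 1
  push_cast
  ring

/-- `f` is symmetric in the two primitive cube roots of unity `exp (± i α)`. -/
lemma f_eq_of_phase (hσ : σ ^ 2 + σ + 1 = 0) (l : ℂ) :
    f l = 2 * (π : ℂ) * airyAiDeriv (σ ^ 2 * l) * airyAiDeriv (σ * l) := by
  have hsum : rayPlus + rayMinus = 1 := by rw [rayPlus_eq, rayMinus_eq]; ring
  rw [f, exp_alpha_eq, exp_neg_alpha_eq, rayPlus_sq, rayMinus_sq]
  have hσ2 : σ ^ 2 = -1 - σ := by linear_combination hσ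
  have hfac : (σ - (rayPlus - 1)) * (σ - (rayMinus - 1)) = 0 := by
    linear_combination hσ - (σ + 1 - rayPlus) * hsum - rayPlus_sq
  rcases mul_eq_zero.1 hfac with h | h
  · have h1 : rayPlus - 1 = σ := by linear_combination -h
    have h2 : rayMinus - 1 = σ ^ 2 := by linear_combination hsum + h - hσ2
    rw [h1, h2]
  · have h1 : rayMinus - 1 = σ := by linear_combination -h
    have h2 : rayPlus - 1 = σ ^ 2 := by linear_combination hsum + h - hσ2
    rw [h1, h2]
    ring

/-- The Wronskian of `Ai w` and `Ai (σ ^ 2 w)`. -/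
def phaseWronskian (σ : ℂ) : ℂ := (σ ^ 2 - 1) * (airyAi 0 * airyAiDeriv 0)

lemma norm_phaseWronskian (hσ : σ ^ 2 + σ + 1 = 0) : ‖phaseWronskian σ‖ = (2 * π)⁻¹ := by
  have h3 : (√3 : ℝ) ≠ 0 := by positivity
  have hpos : 0 < 1 / (2 * π * √3) := by positivity
  rw [phaseWronskian, norm_mul, phase_sq_norm_sub_one hσ, airyAi_zero_mul_airyAiDeriv_zero,
    Complex.norm_real, norm_neg, Real.norm_of_nonneg hpos.le]
  field_simp

/-- The derivative of `f` in terms of the Wronskian and of the product `Ai' w Ai (σ ^ 2 w)`, where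
`w = σ ^ 2 l`. -/
lemma hasDerivAt_f (hσ : σ ^ 2 + σ + 1 = 0) (l : ℂ) :
    HasDerivAt f (2 * π * σ ^ 2 * l *
      (phaseWronskian σ + 2 * (airyAiDeriv (σ ^ 2 * l) * airyAi (σ ^ 2 * (σ ^ 2 * l))))) l := by
  have h3 := phase_cube hσ
  have hm : ∀ c : ℂ, HasDerivAt (fun l : ℂ => c * l) c l := fun c => by
    simpa using (hasDerivAt_id l).const_mul c
  have h1 : ∀ c : ℂ, HasDerivAt (fun l => airyAiDeriv (c * l)) (c * l * airyAi (c * l) * c) l :=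
    fun c => (hasDerivAt_airyAiDeriv (c * l)).comp l (hm c)
  rw [funext (f_eq_of_phase hσ)]
  refine (((h1 (σ ^ 2)).const_mul (2 * (π : ℂ))).mul (h1 σ)).congr_deriv ?_
  have hτ : (σ ^ 2) ^ 3 = 1 := by rw [← pow_mul, mul_comm, pow_mul, h3, one_pow]
  have hW := wronskian_airyAi hτ (σ ^ 2 * l)
  have e : σ ^ 2 * (σ ^ 2 * l) = σ * l := by linear_combination σ * l * h3
  rw [e] at hW ⊢
  rw [phaseWronskian, ← hW]
  ring

end Phase

/-! ### The rescaled functions are nearly linear -/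

section Phase

variable {σ : ℂ}

/-- The derivative of `phi l` at `0`, for `l = σ a'` and `a'` a zero of `Ai'`. -/
def phiSlope (σ : ℂ) : ℂ := 2 * π * σ ^ 2 * phaseWronskian σ

lemma norm_two_pi_mul_sq (hσ : σ ^ 2 + σ + 1 = 0) : ‖2 * (π : ℂ) * σ ^ 2‖ = 2 * π := by
  rw [norm_mul, norm_mul, norm_pow, phase_norm hσ, Complex.norm_real,
    Real.norm_of_nonneg Real.pi_pos.le]
  norm_num

lemma norm_phiSlope (hσ : σ ^ 2 + σ + 1 = 0) : ‖phiSlope σ‖ = 1 := by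
  rw [phiSlope, norm_mul, norm_phaseWronskian hσ, norm_two_pi_mul_sq hσ]
  exact mul_inv_cancel₀ (by positivity)

/-- The derivative of `phi l` at `t`, for `l = σ a`; here `a + σ t / a` is the preimage of
`l + t / l` under multiplication by `σ`. -/
lemma hasDerivAt_phi (hσ : σ ^ 2 + σ + 1 = 0) {a : ℂ} (ha : a ≠ 0) (t : ℂ) :
    HasDerivAt (phi (σ * a)) (2 * π * σ ^ 2 * (1 + σ * t / a ^ 2) * (phaseWronskian σ +
      2 * (airyAiDeriv (a + σ * t / a) * airyAi (σ ^ 2 * (a + σ * t / a))))) t := by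
  have h3 := phase_cube hσ
  have hσ0 : σ ≠ 0 := by
    rintro rfl
    simp at hσ
  have hinv : (σ * a)⁻¹ = σ ^ 2 / a := by
    field_simp
    rw [h3]
  have hm : HasDerivAt (fun t : ℂ => σ * a + t * (σ * a)⁻¹) (σ * a)⁻¹ t := by
    simpa using ((hasDerivAt_id t).mul_const (σ * a)⁻¹).const_add (σ * a)
  have h := (hasDerivAt_f hσ (σ * a + t * (σ * a)⁻¹)).comp t hm
  have e1 : σ ^ 2 * (σ * a + t * (σ * a)⁻¹) = a + σ * t / a := by
    rw [hinv]
    linear_combination (a + σ * t / a) * h3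
  have e2 : (σ * a + t * (σ * a)⁻¹) * (σ * a)⁻¹ = 1 + σ * t / a ^ 2 := by
    rw [hinv]
    field_simp
    linear_combination (a ^ 2 + σ * t) * h3
  rw [e1] at h
  exact h.congr_deriv (by rw [← e2]; ring)

lemma deriv_phi_zero (hσ : σ ^ 2 + σ + 1 = 0) {a : ℂ} (ha : a ≠ 0) (ha' : airyAiDeriv a = 0) :
    deriv (phi (σ * a)) 0 = phiSlope σ := by
  rw [(hasDerivAt_phi hσ ha 0).deriv, phiSlope]
  simp [ha']

lemma phi_zero (hσ : σ ^ 2 + σ + 1 = 0) {a : ℂ} (ha' : airyAiDeriv a = 0) :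
    phi (σ * a) 0 = 0 := by
  have e : σ ^ 2 * (σ * a) = a := by linear_combination a * phase_cube hσ
  rw [phi, zero_mul, add_zero, f_eq_of_phase hσ, e, ha']
  ring

/-- Near a zero `a` of `Ai'` the product `Ai' w Ai (σ ^ 2 w)` is controlled by its analogue
`Ai a Ai (σ ^ 2 a)` at `a`, up to the Wronskian. -/
lemma norm_airyAiDeriv_mul_le (hσ : σ ^ 2 + σ + 1 = 0) {a : ℂ} {η : ℝ} (hη : 0 < η)
    (ha : airyAiDeriv a = 0) (h1 : η ≤ ‖a‖ ^ 2) (h2 : 4 * η ^ 2 ≤ ‖a‖) {w : ℂ}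
    (hw : ‖w - a‖ ≤ η / ‖a‖) :
    ‖airyAiDeriv w * airyAi (σ ^ 2 * w)‖
      ≤ 8 * η * (‖airyAi a * airyAi (σ ^ 2 * a)‖ + η / ‖a‖ * (2 * π)⁻¹) := by
  have ha0 : 0 < ‖a‖ := by nlinarith
  set r := η / ‖a‖ with hr
  have hτ : (σ ^ 2) ^ 3 = 1 := by rw [← pow_mul, mul_comm, pow_mul, phase_cube hσ, one_pow]
  have hrA : r ≤ ‖a‖ := by rw [hr, div_le_iff₀ ha0]; nlinarith
  have hB : ∀ z ∈ Metric.closedBall a r, ‖z‖ ≤ 2 * ‖a‖ := by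
    intro z hz
    have h3 : ‖z - a‖ ≤ r := by simpa [dist_eq_norm] using hz
    have h4 := norm_sub_norm_le z a
    linarith
  have hBr1 : 2 * ‖a‖ * r = 2 * η := by rw [hr]; field_simp
  have hBr : 2 * ‖a‖ * r ^ 2 ≤ 1 / 2 := by
    have e : 2 * ‖a‖ * r ^ 2 = 2 * η ^ 2 / ‖a‖ := by rw [hr]; field_simp
    rw [e, div_le_iff₀ ha0]
    linarith
  have hwmem : w ∈ Metric.closedBall a r := by simpa [dist_eq_norm] using hw
  have hm : ∀ z : ℂ, HasDerivAt (fun z : ℂ => σ ^ 2 * z) (σ ^ 2) z := fun z => by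
    simpa using (hasDerivAt_id z).const_mul (σ ^ 2)
  have hV : ∀ z, HasDerivAt (fun z => airyAi (σ ^ 2 * z)) (σ ^ 2 * airyAiDeriv (σ ^ 2 * z)) z :=
    fun z => ((hasDerivAt_airyAi _).comp z (hm z)).congr_deriv (by ring)
  have hV' : ∀ z, HasDerivAt (fun z => σ ^ 2 * airyAiDeriv (σ ^ 2 * z))
      (z * airyAi (σ ^ 2 * z)) z :=
    fun z => (((hasDerivAt_airyAiDeriv _).comp z (hm z)).const_mul (σ ^ 2)).congr_deriv (by
      linear_combination (z * airyAi (σ ^ 2 * z)) * hτ)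
  have hu := (airy_bound_of_mem_closedBall hasDerivAt_airyAi hasDerivAt_airyAiDeriv hB hBr hwmem).2
  have hv := (airy_bound_of_mem_closedBall hV hV' hB hBr hwmem).1
  rw [ha, norm_zero, mul_zero, add_zero, zero_add, mul_assoc 2 (2 * ‖a‖) r, hBr1] at hu
  have hW : ‖airyAi a‖ * ‖σ ^ 2 * airyAiDeriv (σ ^ 2 * a)‖ = (2 * π)⁻¹ := by
    have h := wronskian_airyAi hτ a
    rw [ha, zero_mul, sub_zero] at h
    rw [← norm_mul, h]
    exact norm_phaseWronskian hσ
  calc ‖airyAiDeriv w * airyAi (σ ^ 2 * w)‖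
      ≤ 2 * (2 * η) * ‖airyAi a‖ *
        (2 * (‖airyAi (σ ^ 2 * a)‖ + r * ‖σ ^ 2 * airyAiDeriv (σ ^ 2 * a)‖)) := by
        rw [norm_mul]
        exact mul_le_mul hu hv (norm_nonneg _) (by positivity)
    _ = 8 * η * (‖airyAi a‖ * ‖airyAi (σ ^ 2 * a)‖
          + r * (‖airyAi a‖ * ‖σ ^ 2 * airyAiDeriv (σ ^ 2 * a)‖)) := by ring
    _ = _ := by rw [hW, norm_mul]

lemma norm_deriv_phi_sub_le (hσ : σ ^ 2 + σ + 1 = 0) {a : ℂ} {η : ℝ} (hη : 0 < η)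
    (ha : airyAiDeriv a = 0) (h1 : η ≤ ‖a‖ ^ 2) (h2 : 4 * η ^ 2 ≤ ‖a‖) {t : ℂ} (ht : ‖t‖ ≤ η) :
    ‖deriv (phi (σ * a)) t - phiSlope σ‖ ≤ η / ‖a‖ ^ 2 +
      8 * π * (8 * η * (‖airyAi a * airyAi (σ ^ 2 * a)‖ + η / ‖a‖ * (2 * π)⁻¹)) := by
  have ha0 : 0 < ‖a‖ := by nlinarith
  set P := airyAiDeriv (a + σ * t / a) * airyAi (σ ^ 2 * (a + σ * t / a)) with hP
  have hPle : ‖P‖ ≤ 8 * η * (‖airyAi a * airyAi (σ ^ 2 * a)‖ + η / ‖a‖ * (2 * π)⁻¹) := by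
    refine norm_airyAiDeriv_mul_le hσ hη ha h1 h2 ?_
    rw [add_sub_cancel_left, norm_div, norm_mul, phase_norm hσ, one_mul]
    gcongr
  rw [(hasDerivAt_phi hσ (norm_pos_iff.1 ha0) t).deriv, phiSlope, ← hP]
  have e : 2 * π * σ ^ 2 * (1 + σ * t / a ^ 2) * (phaseWronskian σ + 2 * P)
      - 2 * π * σ ^ 2 * phaseWronskian σ = 2 * π * σ ^ 2 *
        (σ * t / a ^ 2 * phaseWronskian σ + (1 + σ * t / a ^ 2) * (2 * P)) := by ring
  have hq : ‖σ * t / a ^ 2‖ ≤ η / ‖a‖ ^ 2 := by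
    rw [norm_div, norm_mul, phase_norm hσ, one_mul, norm_pow]
    gcongr
  have hq1 : η / ‖a‖ ^ 2 ≤ 1 := by
    rw [div_le_one (by positivity)]; exact h1
  have hq2 : ‖1 + σ * t / a ^ 2‖ ≤ 2 := by
    refine (norm_add_le _ _).trans ?_
    rw [norm_one]
    linarith
  rw [e, norm_mul, norm_two_pi_mul_sq hσ]
  calc 2 * π * ‖σ * t / a ^ 2 * phaseWronskian σ + (1 + σ * t / a ^ 2) * (2 * P)‖
      ≤ 2 * π * (η / ‖a‖ ^ 2 * (2 * π)⁻¹ + 2 * (2 * ‖P‖)) := by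
        gcongr
        refine (norm_add_le _ _).trans (add_le_add ?_ ?_)
        · rw [norm_mul, norm_phaseWronskian hσ]
          gcongr
        · rw [norm_mul, norm_mul, Complex.norm_ofNat]
          gcongr
    _ = η / ‖a‖ ^ 2 + 8 * π * ‖P‖ := by field_simp; ring
    _ ≤ _ := by gcongr

/-- On every fixed disc `phi` becomes arbitrarily close to a linear function of slope of modulus
`1`; only the accuracy `1 / 4` is recorded. -/
theorem eventually_norm_deriv_phi_sub_le (hσ : σ ^ 2 + σ + 1 = 0) {η : ℝ} (hη : 0 < η) :
    ∀ᶠ n in atTop, ∀ t ∈ Metric.ball (0 : ℂ) η,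
      ‖deriv (phi (σ * aPrime n)) t - phiSlope σ‖ ≤ 1 / 4 := by
  have hτ : (σ ^ 2) ^ 3 = 1 := by rw [← pow_mul, mul_comm, pow_mul, phase_cube hσ, one_pow]
  have hm : ∀ z : ℂ, HasDerivAt (fun z : ℂ => σ ^ 2 * z) (σ ^ 2) z := fun z => by
    simpa using (hasDerivAt_id z).const_mul (σ ^ 2)
  have hu := tendsto_airy_atBot hasDerivAt_airyAi hasDerivAt_airyAiDeriv
  have hv := tendsto_airy_atBot (F := fun z => airyAi (σ ^ 2 * z))
    (F' := fun z => σ ^ 2 * airyAiDeriv (σ ^ 2 * z))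
    (fun z => ((hasDerivAt_airyAi _).comp z (hm z)).congr_deriv (by ring))
    (fun z => (((hasDerivAt_airyAiDeriv _).comp z (hm z)).const_mul (σ ^ 2)).congr_deriv (by
      linear_combination (z * airyAi (σ ^ 2 * z)) * hτ))
  have huv : Tendsto (fun n => ‖airyAi (aPrime n) * airyAi (σ ^ 2 * aPrime n)‖) atTop (𝓝 0) := by
    have h := ((hu.mul hv).comp tendsto_aPrime).norm
    rw [mul_zero, norm_zero] at h
    exact h
  have hA : Tendsto (fun n => ‖(aPrime n : ℂ)‖) atTop atTop := by
    simp only [Complex.norm_real, Real.norm_eq_abs]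
    exact tendsto_abs_atBot_atTop.comp tendsto_aPrime
  have hA2 : Tendsto (fun n => ‖(aPrime n : ℂ)‖ ^ 2) atTop atTop :=
    (tendsto_pow_atTop two_ne_zero).comp hA
  have hbound := (hA2.const_div_atTop η).add
    (((huv.add ((hA.const_div_atTop η).mul_const (2 * π)⁻¹)).const_mul (8 * η)).const_mul (8 * π))
  simp only [zero_mul, mul_zero, add_zero] at hbound
  filter_upwards [hA2.eventually_ge_atTop η, hA.eventually_ge_atTop (4 * η ^ 2),
    hbound.eventually_le_const (by norm_num : (0 : ℝ) < 1 / 4), eventually_ge_atTop 1]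
    with n h1 h2 h3 hn t ht
  obtain ⟨m, rfl⟩ := Nat.exists_eq_add_of_le' hn
  exact (norm_deriv_phi_sub_le hσ hη (aPrime_mem m) h1 h2 (mem_ball_zero_iff.1 ht).le).trans h3

lemma exists_norm_deriv_phi_sub_le (hσ : σ ^ 2 + σ + 1 = 0) {n : ℕ} (hn : 1 ≤ n) :
    ∀ᶠ η in 𝓝[>] (0 : ℝ), ∀ t ∈ Metric.ball (0 : ℂ) η,
      ‖deriv (phi (σ * aPrime n)) t - phiSlope σ‖ ≤ 1 / 4 := by
  obtain ⟨m, rfl⟩ := Nat.exists_eq_add_of_le' hn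
  have hmem := aPrime_mem m
  set a := aPrime (m + 1)
  have ha : (a : ℂ) ≠ 0 := Complex.ofReal_ne_zero.2 (neg_of_mem_airyAiDerivZeros hmem).ne
  have hd : Differentiable ℂ (phi (σ * a)) := fun t => (hasDerivAt_phi hσ ha t).differentiableAt
  have hc : Continuous (deriv (phi (σ * a))) :=
    (hd.contDiff (n := 1)).continuous_deriv le_rfl
  have h0 := hc.tendsto 0
  rw [deriv_phi_zero hσ ha hmem] at h0
  obtain ⟨δ, hδ, h⟩ := Metric.mem_nhds_iff.1
    (h0 (Metric.closedBall_mem_nhds (phiSlope σ) (by norm_num : (0 : ℝ) < 1 / 4)))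
  filter_upwards [Ioo_mem_nhdsGT hδ] with η hη t ht
  have := h (Metric.ball_subset_ball hη.2.le ht)
  simpa [dist_eq_norm] using this

/-- A single radius serves for all zeros. -/
theorem exists_forall_norm_deriv_phi_sub_le (hσ : σ ^ 2 + σ + 1 = 0) :
    ∀ᶠ η in 𝓝[>] (0 : ℝ), ∀ n, 1 ≤ n → ∀ t ∈ Metric.ball (0 : ℂ) η,
      ‖deriv (phi (σ * aPrime n)) t - phiSlope σ‖ ≤ 1 / 4 := by
  obtain ⟨N, hN⟩ := eventually_atTop.1 (eventually_norm_deriv_phi_sub_le hσ one_pos)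
  have hfin : ∀ᶠ η in 𝓝[>] (0 : ℝ), ∀ n ∈ Finset.Icc 1 N, ∀ t ∈ Metric.ball (0 : ℂ) η,
      ‖deriv (phi (σ * aPrime n)) t - phiSlope σ‖ ≤ 1 / 4 :=
    (Filter.eventually_all_finset _).2 fun n hn =>
      exists_norm_deriv_phi_sub_le hσ (Finset.mem_Icc.1 hn).1
  filter_upwards [hfin, Ioo_mem_nhdsGT one_pos] with η h1 h2 n hn t ht
  rcases le_total n N with h | h
  · exact h1 n (Finset.mem_Icc.2 ⟨hn, h⟩) t ht
  · exact hN n h t (Metric.ball_subset_ball h2.2.le ht)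

end Phase

/-- A map whose derivative is within `1 / 4` of a constant of modulus `1` on a disc is injective
there and covers the disc of half the radius. The solution is the fixed point of
`t ↦ t - c⁻¹ (φ t + κ)`. -/
theorem existsUnique_of_norm_deriv_sub_le {φ : ℂ → ℂ} (hφ : Differentiable ℂ φ) {c : ℂ}
    (hc : ‖c‖ = 1) {η : ℝ} (h : ∀ t ∈ Metric.ball (0 : ℂ) η, ‖deriv φ t - c‖ ≤ 1 / 4)
    (h0 : φ 0 = 0) {κ : ℂ} (hκ : ‖κ‖ < η / 2) :
    ∃! t : ℂ, t ∈ Metric.ball (0 : ℂ) η ∧ φ t = -κ := by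
  have hη : 0 < η := by linarith [norm_nonneg κ]
  have hc0 : c ≠ 0 := by
    rintro rfl
    simp at hc
  set T : ℂ → ℂ := fun t => t - c⁻¹ * (φ t + κ) with hT
  have hTd : ∀ t, HasDerivAt T (1 - c⁻¹ * deriv φ t) t := fun t =>
    (hasDerivAt_id t).sub (((hφ t).hasDerivAt.add_const κ).const_mul c⁻¹)
  have hTle : ∀ x ∈ Metric.ball (0 : ℂ) η, ∀ y ∈ Metric.ball (0 : ℂ) η,
      ‖T y - T x‖ ≤ 1 / 4 * ‖y - x‖ := by
    intro x hx y hy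
    refine (convex_ball (0 : ℂ) η).norm_image_sub_le_of_norm_hasDerivWithin_le
      (fun t _ => (hTd t).hasDerivWithinAt) (fun t ht => ?_) hx hy
    have e : 1 - c⁻¹ * deriv φ t = -(c⁻¹ * (deriv φ t - c)) := by
      field_simp
      ring
    rw [e, norm_neg, norm_mul, norm_inv, hc, inv_one, one_mul]
    exact h t ht
  have hfix : ∀ t, φ t = -κ ↔ T t = t := by
    intro t
    rw [hT, sub_eq_self, mul_eq_zero, or_iff_right (inv_ne_zero hc0), eq_neg_iff_add_eq_zero]
  have hsub : Metric.closedBall (0 : ℂ) (2 * η / 3) ⊆ Metric.ball 0 η :=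
    Metric.closedBall_subset_ball (by linarith)
  have h0mem : (0 : ℂ) ∈ Metric.closedBall (0 : ℂ) (2 * η / 3) :=
    Metric.mem_closedBall_self (by linarith)
  have hmaps : MapsTo T (Metric.closedBall 0 (2 * η / 3)) (Metric.closedBall 0 (2 * η / 3)) := by
    intro t ht
    have h1 := hTle 0 (hsub h0mem) t (hsub ht)
    have hT0 : ‖T 0‖ = ‖κ‖ := by simp [hT, h0, hc]
    rw [mem_closedBall_zero_iff] at ht ⊢
    rw [sub_zero] at h1
    have h2 := norm_sub_norm_le (T t) (T 0)
    linarith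
  have hcontr : ContractingWith (1 / 4) (hmaps.restrict T _ _) := by
    refine ⟨by rw [← NNReal.coe_lt_coe]; norm_num, LipschitzWith.of_dist_le_mul fun x y => ?_⟩
    have := hTle y (hsub y.2) x (hsub x.2)
    rw [Subtype.dist_eq, Subtype.dist_eq, dist_eq_norm, dist_eq_norm]
    simpa using this
  obtain ⟨t, ht, hTt, -⟩ := hcontr.exists_fixedPoint'
    Metric.isClosed_closedBall.isComplete hmaps h0mem (edist_ne_top _ _)
  refine ⟨t, ⟨hsub ht, (hfix t).2 hTt⟩, fun s hs => ?_⟩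
  have h1 := hTle t (hsub ht) s hs.1
  rw [(hfix s).1 hs.2, hTt] at h1
  exact sub_eq_zero.1 (norm_le_zero_iff.1 (by linarith [norm_nonneg (s - t)]))

/-- Transfer of a unique solution from `phi l` to `f`, by `z = l + t / l`. -/
lemma existsUnique_f_of_phi {l : ℂ} (hl : l ≠ 0) {η : ℝ} {κ : ℂ}
    (h : ∃! t : ℂ, t ∈ Metric.ball (0 : ℂ) η ∧ phi l t = -κ) :
    ∃! z : ℂ, z ∈ Metric.ball l (η * ‖l‖⁻¹) ∧ f z = -κ := by
  have hl0 : 0 < ‖l‖ := norm_pos_iff.2 hl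
  have hiff : ∀ t : ℂ, t ∈ Metric.ball (0 : ℂ) η ↔ l + t * l⁻¹ ∈ Metric.ball l (η * ‖l‖⁻¹) := by
    intro t
    rw [mem_ball_zero_iff, mem_ball_iff_norm, add_sub_cancel_left, norm_mul, norm_inv]
    exact (mul_lt_mul_iff_of_pos_right (inv_pos.2 hl0)).symm
  obtain ⟨t, ⟨ht, hφ⟩, hu⟩ := h
  refine ⟨l + t * l⁻¹, ⟨(hiff t).1 ht, hφ⟩, fun z hz => ?_⟩
  have e : l + (z - l) * l * l⁻¹ = z := by
    field_simp
    ring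
  have hs := hu ((z - l) * l) ⟨(hiff _).2 (by rw [e]; exact hz.1), by
    rw [phi, e]; exact hz.2⟩
  rw [← hs, e]

lemma rayPlus_sq_phase : (rayPlus ^ 2) ^ 2 + rayPlus ^ 2 + 1 = 0 := by
  linear_combination (rayPlus ^ 2 + rayPlus + 1) * rayPlus_sq

lemma rayMinus_sq_phase : (rayMinus ^ 2) ^ 2 + rayMinus ^ 2 + 1 = 0 := by
  linear_combination (rayMinus ^ 2 + rayMinus + 1) * rayMinus_sq

lemma lamPlus_eq (n : ℕ) : lamPlus n = rayPlus ^ 2 * aPrime n := by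
  rw [lamPlus, exp_alpha_eq]

lemma lamMinus_eq (n : ℕ) : lamMinus n = rayMinus ^ 2 * aPrime n := by
  rw [lamMinus, exp_neg_alpha_eq]

lemma existsUnique_f_of_norm_deriv_phi_sub_le {σ : ℂ} (hσ : σ ^ 2 + σ + 1 = 0) {n : ℕ} (hn : 1 ≤ n)
    {η : ℝ} (h : ∀ t ∈ Metric.ball (0 : ℂ) η,
      ‖deriv (phi (σ * aPrime n)) t - phiSlope σ‖ ≤ 1 / 4) {κ : ℂ} (hκ : ‖κ‖ < η / 2) :
    ∃! z : ℂ, z ∈ Metric.ball (σ * aPrime n) (η * ‖σ * aPrime n‖⁻¹) ∧ f z = -κ := by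
  obtain ⟨m, rfl⟩ := Nat.exists_eq_add_of_le' hn
  have hmem := aPrime_mem m
  have ha : (aPrime (m + 1) : ℂ) ≠ 0 :=
    Complex.ofReal_ne_zero.2 (neg_of_mem_airyAiDerivZeros hmem).ne
  have hσ0 : σ ≠ 0 := by
    rintro rfl
    simp at hσ
  exact existsUnique_f_of_phi (mul_ne_zero hσ0 ha) (existsUnique_of_norm_deriv_sub_le
    (fun t => (hasDerivAt_phi hσ ha t).differentiableAt) (norm_phiSlope hσ) h (phi_zero hσ hmem) hκ)

end ComplexAiry

end

theorem mainTheorem5 :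
    (∃ η : ℝ, 0 < η ∧ ∃ h : ℝ, 0 < h ∧
      ∀ n : ℕ, 1 ≤ n → ∀ l : ℂ, l = ComplexAiry.lamPlus n ∨ l = ComplexAiry.lamMinus n →
        ∀ κ : ℂ, ‖κ‖ ≤ h →
          ∃! z : ℂ, z ∈ Metric.ball l (η * ‖l‖⁻¹) ∧ ComplexAiry.f z = -κ) ∧
    (∀ η : ℝ, 0 < η → ∀ κ : ℝ, 0 ≤ κ → κ < η / 2 →
      ∃ N : ℕ, ∀ n : ℕ, N ≤ n →
        ∀ l : ℂ, l = ComplexAiry.lamPlus n ∨ l = ComplexAiry.lamMinus n →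
          ∃! z : ℂ, z ∈ Metric.ball l (η * ‖l‖⁻¹) ∧ ComplexAiry.f z = -(κ : ℂ)) ∧
    (∀ η : ℝ, 0 < η →
      ∃ N : ℕ, ∀ n : ℕ, N ≤ n →
        ∀ l : ℂ, l = ComplexAiry.lamPlus n ∨ l = ComplexAiry.lamMinus n →
          ∀ t ∈ Metric.ball (0 : ℂ) η, 1 / 2 ≤ ‖deriv (ComplexAiry.phi l) t‖) := by
  open ComplexAiry in
  have hp := rayPlus_sq_phase
  have hm := rayMinus_sq_phase
  refine ⟨?_, fun η hη κ hκ0 hκ => ?_, fun η hη => ?_⟩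
  · obtain ⟨η, ⟨h1, h2⟩, hη⟩ := ((exists_forall_norm_deriv_phi_sub_le hp).and
      (exists_forall_norm_deriv_phi_sub_le hm) |>.and self_mem_nhdsWithin).exists
    refine ⟨η, hη, η / 4, by positivity, fun n hn l hl κ hκ => ?_⟩
    rcases hl with rfl | rfl
    · rw [lamPlus_eq]
      exact existsUnique_f_of_norm_deriv_phi_sub_le hp hn (h1 n hn) (by linarith)
    · rw [lamMinus_eq]
      exact existsUnique_f_of_norm_deriv_phi_sub_le hm hn (h2 n hn) (by linarith)
  · obtain ⟨N, hN⟩ := Filter.eventually_atTop.1 ((eventually_norm_deriv_phi_sub_le hp hη).and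
      (eventually_norm_deriv_phi_sub_le hm hη))
    have hκ' : ‖(κ : ℂ)‖ < η / 2 := by rwa [Complex.norm_real, Real.norm_of_nonneg hκ0]
    refine ⟨max N 1, fun n hn l hl => ?_⟩
    obtain ⟨h1, h2⟩ := hN n (le_of_max_le_left hn)
    rcases hl with rfl | rfl
    · rw [lamPlus_eq]
      exact existsUnique_f_of_norm_deriv_phi_sub_le hp (le_of_max_le_right hn) h1 hκ'
    · rw [lamMinus_eq]
      exact existsUnique_f_of_norm_deriv_phi_sub_le hm (le_of_max_le_right hn) h2 hκ'
  · obtain ⟨N, hN⟩ := Filter.eventually_atTop.1 ((eventually_norm_deriv_phi_sub_le hp hη).and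
      (eventually_norm_deriv_phi_sub_le hm hη))
    refine ⟨N, fun n hn l hl t ht => ?_⟩
    have key : ∀ {σ d : ℂ}, σ ^ 2 + σ + 1 = 0 → ‖d - phiSlope σ‖ ≤ 1 / 4 → 1 / 2 ≤ ‖d‖ := by
      intro σ d hσ h
      have h1 := norm_sub_norm_le (phiSlope σ) d
      rw [norm_phiSlope hσ, norm_sub_rev] at h1
      linarith
    rcases hl with rfl | rfl
    · rw [lamPlus_eq]
      exact key hp ((hN n hn).1 t ht)
    · rw [lamMinus_eq]
      exact key hm ((hN n hn).2 t ht)
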